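/- Let $n\ge 2$ and let $A$ be an $n\times n$ matrix with entries in $\{0,1\}$ such that, for some integer $m\ge 1$, all entries of $A^m$ are strictly positive. Let $$\Sigma_A=\{x=(x_0,x_1,\dots)\in\{1,\dots,n\}^{\mathbf N}: A_{x_i,x_{i+1}}=1\ \text{for all } i\ge 0\}$$ with the product topology, let $\sigma(x_0,x_1,x_2,\dots)=(x_1,x_2,\dots)$ be the left shift on $\Sigma_A$, and fix $\theta\in(0,1)$ and the metric $d(x,y)=\theta^{N(x,y)}$, where $N(x,y)$ is the largest integer $N$ with $x_i=y_i$ for all $i<N$ (and $d(x,x)=0$). For a real continuous function $\phi$ on $\Sigma_A$ let $\mathcal L_\phi$ be the operator on the space $C(\Sigma_A)$ of continuous complex functions given by $$\mathcal L_\phi(f)(x)=\sum_{y\in\sigma^{-1}(\{x\})}e^{\phi(y)}f(y).$$ Let $H:\Sigma_A\to\mathbf R$ be Hölder continuous with respect to $d$ (that is, $|H(x)-H(y)|\le K\,d(x,y)^{\alpha}$ for all $x,y$, for some constants $K,\alpha>0$), with $H(y)>1$ for all $y\in\Sigma_A$, and for $\beta\ge 0$ put $\phi_\beta=-\beta\log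 H$. Then for every $\beta\ge0$ there is a unique real number $\lambda=\lambda(\beta)>0$ for which there exist a strictly positive function $h\in C(\Sigma_A)$ and a Borel probability measure $\nu$ on $\Sigma_A$ such that 1. $\mathcal L_{\phi_\beta}(h)=\lambda h$, 2. $\int \mathcal L_{\phi_\beta}(f)\,d\nu=\lambda\int f\,d\nu$ for every $f\in C(\Sigma_A)$, 3. $\lim_{k\to\infty}\big\|\lambda^{-k}\mathcal L_{\phi_\beta}^k(g)-\big(\int g\,d\nu\big)h\big\|=0$ in the supremum norm, for every $g\in C(\Sigma_A)$; and there exists a unique $\beta>0$ such that $\lambda(\beta)=1$. -/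

import Mathlib

open Filter Topology MeasureTheory
open scoped ComplexOrder

/-- The one-sided Markov space `Σ_A` of a matrix `A`, with the topology and the (Borel) σ-algebra
induced from the infinite product of copies of the discrete space `Fin n`. -/
abbrev MarkovSpace {n : ℕ} (A : Matrix (Fin n) (Fin n) ℕ) : Type :=
  {x : ℕ → Fin n // ∀ i, A (x i) (x (i + 1)) = 1}

namespace MarkovSpace

variable {n : ℕ} {A : Matrix (Fin n) (Fin n) ℕ}

instance instCompactSpace : CompactSpace (MarkovSpace A) := by
  have hc : IsClosed {x : ℕ → Fin n | ∀ i, A (x i) (x (i + 1)) = 1} := by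
    rw [Set.ofPred_forall]
    refine isClosed_iInter fun i => ?_
    have h : Continuous fun x : ℕ → Fin n => (x i, x (i + 1)) := by fun_prop
    exact (isClosed_discrete {p : Fin n × Fin n | A p.1 p.2 = 1}).preimage h
  exact isCompact_iff_compactSpace.mp hc.isCompact

/-- The left shift `σ (x₀, x₁, x₂, …) = (x₁, x₂, x₃, …)`. -/
def shift (x : MarkovSpace A) : MarkovSpace A :=
  ⟨fun i => x.1 (i + 1), fun i => x.2 (i + 1)⟩

/-- The sequence `(j, x₀, x₁, …)`. -/
def cons (j : Fin n) (x : MarkovSpace A) (h : A j (x.1 0) = 1) : MarkovSpace A :=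
  ⟨fun i => Nat.casesOn i j x.1, fun i => by
    cases i with
    | zero => exact h
    | succ k => exact x.2 k⟩

theorem eq_cons {y x : MarkovSpace A} (h : shift y = x) :
    ∃ hj : A (y.1 0) (x.1 0) = 1, cons (y.1 0) x hj = y := by
  subst h
  refine ⟨y.2 0, Subtype.ext (funext fun i => ?_)⟩
  cases i <;> rfl

theorem shift_cons (j : Fin n) (x : MarkovSpace A) (h : A j (x.1 0) = 1) :
    shift (cons j x h) = x := rfl

theorem finite_preimage_shift (x : MarkovSpace A) : (shift ⁻¹' {x}).Finite := by
  refine Set.Finite.of_injOn (f := fun y : MarkovSpace A => y.1 0) (t := Set.univ)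
    (fun _ _ => trivial) ?_ Set.finite_univ
  intro y hy z hz hyz
  obtain ⟨_, h1⟩ := eq_cons (show shift y = x from hy)
  obtain ⟨_, h2⟩ := eq_cons (show shift z = x from hz)
  rw [← h1, ← h2]
  congr 1

/-- The function `x ↦ ∑_{y ∈ σ⁻¹({x})} f y`. -/
noncomputable def transferFun (f : MarkovSpace A → ℂ) (x : MarkovSpace A) : ℂ :=
  ∑ y ∈ (finite_preimage_shift x).toFinset, f y

theorem transferFun_eq (f : MarkovSpace A → ℂ) (x : MarkovSpace A) :
    transferFun f x = ∑ j : Fin n, if h : A j (x.1 0) = 1 then f (cons j x h) else 0 := by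
  classical
  rw [transferFun, ← Finset.sum_filter_add_sum_filter_not Finset.univ
    (fun j : Fin n => A j (x.1 0) = 1)]
  rw [Finset.sum_eq_zero (s := Finset.univ.filter fun j : Fin n => ¬ A j (x.1 0) = 1), add_zero]
  · refine Finset.sum_bij' (fun y _ => y.1 0)
      (fun j hj => cons j x (by simpa using hj)) ?_ ?_ ?_ ?_ ?_
    · intro y hy
      obtain ⟨h, _⟩ := eq_cons (show shift y = x by simpa using hy)
      simpa using h
    · intro j hj
      simp [shift_cons]
    · intro y hy
      exact (eq_cons (show shift y = x by simpa using hy)).2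
    · intro j hj
      rfl
    · intro y hy
      obtain ⟨h, h'⟩ := eq_cons (show shift y = x by simpa using hy)
      rw [dif_pos h, h']
  · intro j hj
    rw [dif_neg (by simpa using hj)]

theorem continuous_transferFun {f : MarkovSpace A → ℂ} (hf : Continuous f) :
    Continuous (transferFun f) := by
  rw [funext (transferFun_eq f)]
  refine continuous_finsetSum _ fun j _ => ?_
  have h0 : Continuous fun x : MarkovSpace A => x.1 0 :=
    (continuous_apply 0).comp continuous_subtype_val
  have ho (S : Set (Fin n)) : IsOpen {x : MarkovSpace A | x.1 0 ∈ S} :=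
    (isOpen_discrete S).preimage h0
  have h1 : IsOpen {x : MarkovSpace A | A j (x.1 0) = 1} := ho {i | A j i = 1}
  have h2 : IsOpen {x : MarkovSpace A | ¬ A j (x.1 0) = 1} := ho {i | ¬ A j i = 1}
  rw [continuous_iff_continuousAt]
  intro x
  by_cases hx : A j (x.1 0) = 1
  · refine ContinuousOn.continuousAt ?_ (h1.mem_nhds hx)
    rw [continuousOn_iff_continuous_domRestrict]
    have he : Set.domRestrict {x : MarkovSpace A | A j (x.1 0) = 1}
        (fun x => if h : A j (x.1 0) = 1 then f (cons j x h) else 0) =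
        fun x => f (cons j x.1 x.2) := by
      funext x
      exact dif_pos x.2
    rw [he]
    refine hf.comp (Continuous.subtype_mk (continuous_pi fun i => ?_) _)
    cases i with
    | zero => exact continuous_const
    | succ k =>
      exact (continuous_apply k).comp (continuous_subtype_val.comp continuous_subtype_val)
  · refine ContinuousOn.continuousAt ?_ (h2.mem_nhds hx)
    exact continuousOn_const.congr fun y hy => dif_neg hy

theorem norm_transferFun_le (f : C(MarkovSpace A, ℂ)) (x : MarkovSpace A) :
    ‖transferFun f x‖ ≤ n * ‖f‖ := by
  rw [transferFun_eq]
  refine (norm_sum_le _ _).trans ?_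
  refine (Finset.sum_le_card_nsmul _ _ ‖f‖ fun j _ => ?_).trans (by simp)
  split_ifs
  · exact f.norm_coe_le_norm _
  · simp

/-- The bounded operator `(𝓛 f)(x) = ∑_{y ∈ σ⁻¹({x})} f y` on `C(Σ_A)`. -/
noncomputable def transfer : C(MarkovSpace A, ℂ) →L[ℂ] C(MarkovSpace A, ℂ) :=
  LinearMap.mkContinuous
    { toFun := fun f => ⟨transferFun f, continuous_transferFun f.continuous⟩
      map_add' := fun f g => by
        ext x
        simp [transferFun, Finset.sum_add_distrib]
      map_smul' := fun c f => by
        ext x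
        simp [transferFun, Finset.mul_sum] }
    n fun f => (ContinuousMap.norm_le _ (by positivity)).2 fun x => norm_transferFun_le f x

/-- The continuous complex function `e^φ`, for a real continuous function `φ`. -/
noncomputable def expC (φ : C(MarkovSpace A, ℝ)) : C(MarkovSpace A, ℂ) :=
  ⟨fun x => (Real.exp (φ x) : ℂ), by fun_prop⟩

/-- Ruelle's transfer operator `𝓛_φ(f) = 𝓛(e^φ f)`. -/
noncomputable def ruelleOp (φ : C(MarkovSpace A, ℝ)) :
    C(MarkovSpace A, ℂ) →L[ℂ] C(MarkovSpace A, ℂ) :=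
  transfer.comp (ContinuousLinearMap.mul ℂ C(MarkovSpace A, ℂ) (expC φ))

/-- The metric `d(x, y) = θ ^ N(x, y)`, where `N(x, y)` is the largest `N` such that `x i = y i`
for all `i < N`, that is, the first index at which `x` and `y` differ; `d(x, x) = 0`. -/
noncomputable def markovDist (θ : ℝ) (x y : MarkovSpace A) : ℝ :=
  open Classical in
  if x = y then 0 else θ ^ PiNat.firstDiff (E := fun _ => Fin n) x.1 y.1

/-- Hölder continuity with respect to `markovDist θ`. -/
def IsHolder (θ : ℝ) (φ : MarkovSpace A → ℝ) : Prop :=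
  ∃ K α : ℝ, 0 < K ∧ 0 < α ∧ ∀ x y, |φ x - φ y| ≤ K * markovDist θ x y ^ α

/-- `lam` is a positive number which, together with some strictly positive continuous function `h`
and some Borel probability measure `ν`, satisfies the three conclusions of Ruelle's
Perron-Frobenius theorem for `φ`. -/
def IsRuelleEigenvalue (φ : C(MarkovSpace A, ℝ)) (lam : ℝ) : Prop :=
  0 < lam ∧ ∃ (h : C(MarkovSpace A, ℂ)) (ν : Measure (MarkovSpace A)),
    (∀ x, 0 < h x) ∧ IsProbabilityMeasure ν ∧
    ruelleOp φ h = (lam : ℂ) • h ∧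
    (∀ f : C(MarkovSpace A, ℂ), ∫ x, ruelleOp φ f x ∂ν = (lam : ℂ) * ∫ x, f x ∂ν) ∧
    ∀ g : C(MarkovSpace A, ℂ),
      Tendsto (fun k : ℕ => ‖((lam : ℂ) ^ k)⁻¹ • (ruelleOp φ ^ k) g - (∫ x, g x ∂ν) • h‖)
        atTop (𝓝 0)

/-- The potential `φ_β = -β log H`, for a strictly positive continuous function `H`. -/
noncomputable def potential (H : C(MarkovSpace A, ℝ)) (hH : ∀ x, 0 < H x) (β : ℝ) :
    C(MarkovSpace A, ℝ) :=
  ⟨fun x => -β * Real.log (H x),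
    continuous_const.mul (H.continuous.log fun x => (hH x).ne')⟩

end MarkovSpace

/-!
Ruelle's Perron-Frobenius theorem is proved by a cone contraction. Let `L` be the transfer operator
on real functions and let `K` be the cone `logLipCone A r B` of nonnegative functions whose
logarithm varies by at most `B * r ^ N` on cylinders of length `N + 1`. Inverse branches of the
shift lengthen common cylinders, so for large `B` the operator maps `K` into a strictly smaller cone
of the same kind (`realOp_mem_logLipCone`). Together with primitivity of `A`, which bounds `L ^ m w`
below by a multiple of any single value of `w` (`le_realOp_pow_apply`), this gives `exists_gap`: for `v, w` in
`K`, the function `‖v‖ • L ^ m w - (δ * w z) • L ^ m v` is in `K`, with a constant `δ > 0` that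
depends on neither `v`, `w` nor the point `z`.

The gap does all the work. The eigenfunction `h` and the eigenvalue come from maximizing `t` subject
to `L f - t • f ∈ K` over the normalized part of `K`, which is compact by Arzelà-Ascoli; the gap
shows that a maximizer is an eigenfunction (`IsConeContraction.exists_eigenfunction`). For the
normalized operator `T`, the gap shrinks by a fixed factor every interval `[a, b]` such that
`a • h ≤ T ^ k u ≤ b • h` in the order of `K` (`IsConeContraction.exists_sandwich`). Hence
`T ^ k u` converges to a multiple of `h` for `u` in `K`, and then for all continuous functions,
because functions of finitely many coordinates are dense and are differences of elements of `K`.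
The limits form a positive linear functional, whose Riesz measure is the eigenmeasure
(`IsConeContraction.exists_measure`).

Integrating the eigenfunction of one potential against the eigenmeasure of another compares their
eigenvalues (`IsRuelleEigenvalue.le_exp_mul`). This yields uniqueness of the eigenvalue, and, since
`log H` lies between two positive constants, it shows that `log (λ β)` is Lipschitz and decreases at
least linearly. As `λ 0 > 1`, because `A ^ m` has column sums at least `2`, the logarithm has exactly
one positive zero (`existsUnique_pos_zero`).
-/

namespace MarkovSpace

variable {n : ℕ} {A : Matrix (Fin n) (Fin n) ℕ}

section

/-! ### Cylinders and the cone of log-Lipschitz functions -/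

/-- `x` and `y` lie in the same cylinder of length `N + 1`, that is, their coordinates
`0, 1, …, N` coincide. -/
def Agree (N : ℕ) (x y : MarkovSpace A) : Prop := ∀ i ≤ N, x.1 i = y.1 i

theorem Agree.symm {N : ℕ} {x y : MarkovSpace A} (h : Agree N x y) : Agree N y x :=
  fun i hi => (h i hi).symm

theorem Agree.cons {N : ℕ} {x y : MarkovSpace A} (h : Agree N x y) {j : Fin n}
    (hx : A j (x.1 0) = 1) (hy : A j (y.1 0) = 1) :
    Agree (N + 1) (cons j x hx) (cons j y hy) := by
  intro i hi
  cases i with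
  | zero => rfl
  | succ k => exact h k (by omega)

theorem eventually_agree (N : ℕ) (x : MarkovSpace A) : ∀ᶠ y in 𝓝 x, Agree N x y := by
  have h : ∀ i, ∀ᶠ y in 𝓝 x, x.1 i = y.1 i := fun i => by
    have hc : Continuous fun y : MarkovSpace A => y.1 i :=
      (continuous_apply i).comp continuous_subtype_val
    exact mem_of_superset (((isOpen_discrete {x.1 i}).preimage hc).mem_nhds rfl)
      fun y hy => Eq.symm hy
  exact (Filter.eventually_all_finite (Set.finite_Iic N)).2 fun i _ => h i

/-- The cone of nonnegative functions whose logarithm has variation at most `B * r ^ N` on every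
cylinder of length `N + 1`. The multiplicative form of the condition makes it meaningful at the
zeros of the function. -/
def logLipCone (A : Matrix (Fin n) (Fin n) ℕ) (r B : ℝ) : Set C(MarkovSpace A, ℝ) :=
  {f | (∀ x, 0 ≤ f x) ∧ ∀ N x y, Agree N x y → f x ≤ Real.exp (B * r ^ N) * f y}

variable {r B B' : ℝ} {f g : C(MarkovSpace A, ℝ)}

theorem smul_mem_logLipCone {c : ℝ} (hc : 0 ≤ c) (hf : f ∈ logLipCone A r B) :
    c • f ∈ logLipCone A r B := by
  refine ⟨fun x => mul_nonneg hc (hf.1 x), fun N x y h => ?_⟩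
  have h1 := mul_le_mul_of_nonneg_left (hf.2 N x y h) hc
  simp only [ContinuousMap.smul_apply, smul_eq_mul]
  linarith

theorem logLipCone_mono (hr : 0 ≤ r) (hB : B' ≤ B) : logLipCone A r B' ⊆ logLipCone A r B := by
  intro f hf
  refine ⟨hf.1, fun N x y h => (hf.2 N x y h).trans ?_⟩
  have := hf.1 y
  gcongr

theorem one_mem_logLipCone (hr : 0 ≤ r) (hB : 0 ≤ B) :
    (1 : C(MarkovSpace A, ℝ)) ∈ logLipCone A r B := by
  refine ⟨fun x => zero_le_one, fun N x y _ => ?_⟩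
  simpa using Real.one_le_exp (by positivity : 0 ≤ B * r ^ N)

theorem isClosed_logLipCone (r B : ℝ) : IsClosed (logLipCone A r B) := by
  simp only [logLipCone, Set.ofPred_and, Set.ofPred_forall]
  refine IsClosed.inter (isClosed_iInter fun x => ?_) (isClosed_iInter fun N => isClosed_iInter
    fun x => isClosed_iInter fun y => isClosed_iInter fun _ => ?_)
  · exact isClosed_le continuous_const (ContinuousEvalConst.continuous_eval_const x)
  · exact isClosed_le (ContinuousEvalConst.continuous_eval_const x)
      (continuous_const.mul (ContinuousEvalConst.continuous_eval_const y))

/-- A function in the strictly smaller cone `B' < B` stays in the cone `B` after subtraction of a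
small multiple of any function of the smaller cone that it dominates. The multiple depends only on
the parameters and on the domination constant `C`. -/
theorem exists_sub_smul_mem_logLipCone (hr0 : 0 ≤ r) (hr1 : r ≤ 1) (hB' : 0 ≤ B') (hB : B' < B)
    {C : ℝ} (hC : 0 < C) :
    ∃ δ : ℝ, 0 < δ ∧ ∀ f ∈ logLipCone A r B', ∀ g ∈ logLipCone A r B', (∀ x, f x ≤ C * g x) →
      g - δ • f ∈ logLipCone A r B := by
  have hBpos : 0 < B := hB'.trans_lt hB
  have hE : 1 ≤ Real.exp B := Real.one_le_exp hBpos.le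
  set δ : ℝ := (B - B') / (C * ((B + B') * Real.exp B)) with hδ
  have hden : 0 < C * ((B + B') * Real.exp B) := by positivity
  have hδ0 : 0 < δ := div_pos (sub_pos.2 hB) hden
  have hδ1 : δ * (C * ((B + B') * Real.exp B)) = B - B' := div_mul_cancel₀ _ hden.ne'
  refine ⟨δ, hδ0, fun f hf g hg hfg => ⟨fun x => ?_, fun N x y h => ?_⟩⟩
  · have h1 : δ * C ≤ 1 := by
      have h2 : δ * C * ((B + B') * Real.exp B) ≤ 1 * ((B + B') * Real.exp B) := by
        have : (B + B') * 1 ≤ (B + B') * Real.exp B := by gcongr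
        linarith
      exact le_of_mul_le_mul_right h2 (by positivity)
    have h3 : δ * f x ≤ δ * (C * g x) := mul_le_mul_of_nonneg_left (hfg x) hδ0.le
    have h4 : δ * C * g x ≤ 1 * g x := mul_le_mul_of_nonneg_right h1 (hg.1 x)
    simp only [ContinuousMap.sub_apply, ContinuousMap.smul_apply, smul_eq_mul]
    linarith
  · set t := r ^ N
    have ht0 : 0 ≤ t := by positivity
    have ht1 : t ≤ 1 := pow_le_one₀ hr0 hr1
    have hg1 := hg.2 N x y h
    have hf1 := hf.2 N y x h.symm
    have hf2 : Real.exp (-(B' * t)) * f y ≤ f x := by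
      rw [Real.exp_neg, inv_mul_le_iff₀ (Real.exp_pos _)]
      exact hf1
    have hfy := hf.1 y
    have hgy := hg.1 y
    -- lower bound for the gain on `g`
    have e1 : (B - B') * t ≤ Real.exp (B * t) - Real.exp (B' * t) := by
      have h1 := Real.add_one_le_exp ((B - B') * t)
      have h2 : Real.exp (B * t) = Real.exp (B' * t) * Real.exp ((B - B') * t) := by
        rw [← Real.exp_add]; congr 1; ring
      have h3 : 1 ≤ Real.exp (B' * t) := Real.one_le_exp (by positivity)
      have h4 : 0 ≤ (B - B') * t := mul_nonneg (sub_pos.2 hB).le ht0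
      rw [h2]
      nlinarith
    -- upper bound for the loss on `f`
    have e2 : Real.exp (B * t) - Real.exp (-(B' * t)) ≤ (B + B') * t * Real.exp B := by
      have h1 := Real.add_one_le_exp (-((B + B') * t))
      have h2 : Real.exp (-(B' * t)) = Real.exp (B * t) * Real.exp (-((B + B') * t)) := by
        rw [← Real.exp_add]; congr 1; ring
      have h3 : Real.exp (B * t) ≤ Real.exp B := Real.exp_le_exp.2 (by nlinarith)
      have h4 : 0 ≤ (B + B') * t := by positivity
      have h5 := Real.exp_pos (B * t)
      rw [h2]
      nlinarith
    have k1 := mul_le_mul_of_nonneg_right e1 hgy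
    have k2 := mul_le_mul_of_nonneg_right e2 hfy
    have k3 : δ * ((B + B') * t * Real.exp B * f y) ≤ (B - B') * t * g y := by
      have h1 : (B + B') * t * Real.exp B * f y ≤ (B + B') * t * Real.exp B * (C * g y) :=
        mul_le_mul_of_nonneg_left (hfg y) (by positivity)
      have h2 := mul_le_mul_of_nonneg_left h1 hδ0.le
      have h3 : δ * ((B + B') * t * Real.exp B * (C * g y)) = (B - B') * t * g y := by
        rw [← hδ1]; ring
      linarith
    have k4 := mul_le_mul_of_nonneg_left (k2.trans' (by
      show Real.exp (B * t) * f y - f x ≤ _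
      linarith)) hδ0.le
    simp only [ContinuousMap.sub_apply, ContinuousMap.smul_apply, smul_eq_mul]
    linarith

/-- The normalized part of the cone is compact: its elements are equicontinuous because the
exponential bound on cylinders is uniform. -/
theorem isCompact_logLipCone_inter_sphere (hr0 : 0 ≤ r) (hr1 : r < 1) :
    IsCompact (logLipCone A r B ∩ Metric.sphere 0 1) := by
  set S : Set C(MarkovSpace A, ℝ) := {f | f ∈ logLipCone A r B ∧ ∀ x, f x ≤ 1}
  -- oscillations on cylinders of functions that take values in `[0, 1]`
  have hexp : Tendsto (fun N : ℕ => Real.exp (B * r ^ N) - 1) atTop (𝓝 0) := by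
    have h1 : Tendsto (fun N : ℕ => B * r ^ N) atTop (𝓝 (B * 0)) :=
      (tendsto_pow_atTop_nhds_zero_of_lt_one hr0 hr1).const_mul B
    simpa using ((Real.continuous_exp.tendsto _).comp h1).sub_const 1
  have hosc : ∀ ε > 0, ∃ N, ∀ f : MarkovSpace A → ℝ, (∀ x, f x ≤ 1) → (∀ x, 0 ≤ f x) →
      (∀ N x y, Agree N x y → f x ≤ Real.exp (B * r ^ N) * f y) →
      ∀ x y, Agree N x y → |f x - f y| < ε := by
    intro ε hε
    obtain ⟨N, hN⟩ := (hexp.eventually (gt_mem_nhds hε)).exists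
    refine ⟨N, fun f h1 h0 hf x y h => ?_⟩
    have key : ∀ x y, Agree N x y → f x - f y < ε := by
      intro x y h
      have := hf N x y h
      rcases le_total 0 (Real.exp (B * r ^ N) - 1) with h2 | h2
      · nlinarith [mul_le_mul_of_nonneg_left (h1 y) h2]
      · nlinarith [mul_le_mul_of_nonneg_right h2 (h0 y)]
    exact abs_sub_lt_iff.2 ⟨key x y h, key y x h.symm⟩
  have himg : ContinuousMap.toFun '' S = {f : MarkovSpace A → ℝ | (∀ x, f x ∈ Set.Icc 0 1) ∧
      ∀ N x y, Agree N x y → f x ≤ Real.exp (B * r ^ N) * f y} := by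
    ext f
    constructor
    · rintro ⟨f, hf, rfl⟩
      exact ⟨fun x => ⟨hf.1.1 x, hf.2 x⟩, hf.1.2⟩
    · rintro ⟨h1, h2⟩
      refine ⟨⟨f, ?_⟩, ⟨⟨fun x => (h1 x).1, h2⟩, fun x => (h1 x).2⟩, rfl⟩
      rw [continuous_iff_continuousAt]
      intro x
      rw [ContinuousAt, Metric.tendsto_nhds]
      intro ε hε
      obtain ⟨N, hN⟩ := hosc ε hε
      filter_upwards [eventually_agree N x] with y hy
      exact hN f (fun x => (h1 x).2) (fun x => (h1 x).1) h2 y x hy.symm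
  have hcomp : IsCompact S := by
    apply ArzelaAscoli.isCompact_of_equicontinuous
    · rw [himg, Set.ofPred_and]
      refine IsCompact.inter_right ?_ ?_
      · have := isCompact_univ_pi fun _ : MarkovSpace A => isCompact_Icc (a := (0 : ℝ)) (b := 1)
        simpa [Set.pi] using this
      · simp only [Set.ofPred_forall]
        exact isClosed_iInter fun N => isClosed_iInter fun x => isClosed_iInter fun y =>
          isClosed_iInter fun _ => isClosed_le (continuous_apply x)
            (continuous_const.mul (continuous_apply y))
    · intro x
      rw [Metric.equicontinuousAt_iff_right]
      intro ε hε
      obtain ⟨N, hN⟩ := hosc ε hε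
      filter_upwards [eventually_agree N x] with y hy f
      exact hN f.1 f.2.2 f.2.1.1 f.2.1.2 x y hy
  refine hcomp.of_isClosed_subset
    ((isClosed_logLipCone r B).inter Metric.isClosed_sphere) ?_
  rintro f ⟨hf, hf1⟩
  refine ⟨hf, fun x => ?_⟩
  have h1 := f.norm_coe_le_norm x
  have h2 : ‖f‖ = 1 := by simpa using hf1
  rw [h2] at h1
  exact (le_abs_self _).trans h1

/-- A function that depends on finitely many coordinates lies in every cone `B > 0` once a large
constant is added. -/
theorem exists_add_const_mem_logLipCone (hr0 : 0 < r) (hr1 : r ≤ 1) (hB : 0 < B) {p : ℕ}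
    (hf : ∀ x y, Agree p x y → f x = f y) :
    ∃ c : ℝ, 0 ≤ c ∧ f + c • (1 : C(MarkovSpace A, ℝ)) ∈ logLipCone A r B := by
  have hd : 0 < B * r ^ p := by positivity
  refine ⟨‖f‖ + 2 * ‖f‖ / (B * r ^ p), by positivity, fun x => ?_, fun N x y h => ?_⟩
  · have := abs_le.1 (f.norm_coe_le_norm x)
    have h2 : 0 ≤ 2 * ‖f‖ / (B * r ^ p) := by positivity
    simp
    linarith
  · have hx := abs_le.1 (f.norm_coe_le_norm x)
    have hy := abs_le.1 (f.norm_coe_le_norm y)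
    have h2 : 0 ≤ 2 * ‖f‖ / (B * r ^ p) := by positivity
    have he := Real.add_one_le_exp (B * r ^ N)
    simp only [ContinuousMap.add_apply, ContinuousMap.smul_apply, ContinuousMap.one_apply,
      smul_eq_mul, mul_one]
    rcases le_or_gt p N with hN | hN
    · rw [hf x y fun i hi => h i (hi.trans hN)]
      have h3 : 0 ≤ B * r ^ N := by positivity
      exact le_mul_of_one_le_left (by linarith) (by linarith)
    · have h3 : B * r ^ p ≤ B * r ^ N := by
        have := pow_le_pow_of_le_one hr0.le hr1 hN.le
        gcongr
      have h4 : B * r ^ p * (2 * ‖f‖ / (B * r ^ p)) = 2 * ‖f‖ := mul_div_cancel₀ _ hd.ne'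
      set D := 2 * ‖f‖ / (B * r ^ p)
      have h5 : B * r ^ p * D ≤ (Real.exp (B * r ^ N) - 1) * (f y + (‖f‖ + D)) :=
        mul_le_mul (by linarith) (by linarith) h2 (by linarith)
      linarith

end

section

/-! ### The transfer operator on real functions -/

/-- The inclusion of the real continuous functions into the complex ones. -/
noncomputable def ofRealC : C(MarkovSpace A, ℝ) →L[ℝ] C(MarkovSpace A, ℂ) :=
  Complex.ofRealCLM.compLeftContinuous ℝ (MarkovSpace A)

/-- The real part of a complex continuous function. -/
noncomputable def reC : C(MarkovSpace A, ℂ) →L[ℝ] C(MarkovSpace A, ℝ) :=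
  Complex.reCLM.compLeftContinuous ℝ (MarkovSpace A)

/-- The imaginary part of a complex continuous function. -/
noncomputable def imC : C(MarkovSpace A, ℂ) →L[ℝ] C(MarkovSpace A, ℝ) :=
  Complex.imCLM.compLeftContinuous ℝ (MarkovSpace A)

@[simp] theorem ofRealC_apply (f : C(MarkovSpace A, ℝ)) (x : MarkovSpace A) :
    ofRealC f x = (f x : ℂ) := rfl

@[simp] theorem reC_apply (f : C(MarkovSpace A, ℂ)) (x : MarkovSpace A) :
    reC f x = (f x).re := rfl

@[simp] theorem imC_apply (f : C(MarkovSpace A, ℂ)) (x : MarkovSpace A) :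
    imC f x = (f x).im := rfl

theorem ofRealC_re_add_im (f : C(MarkovSpace A, ℂ)) :
    ofRealC (reC f) + Complex.I • ofRealC (imC f) = f := by
  ext x
  simp [mul_comm Complex.I, Complex.re_add_im]

theorem ruelleOp_apply (φ : C(MarkovSpace A, ℝ)) (f : C(MarkovSpace A, ℂ)) (x : MarkovSpace A) :
    ruelleOp φ f x = ∑ j : Fin n, if h : A j (x.1 0) = 1 then
      (Real.exp (φ (cons j x h)) : ℂ) * f (cons j x h) else 0 :=
  transferFun_eq _ x

/-- Ruelle's transfer operator on real functions, as the restriction of the complex one. -/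
noncomputable def realOp (φ : C(MarkovSpace A, ℝ)) :
    C(MarkovSpace A, ℝ) →L[ℝ] C(MarkovSpace A, ℝ) :=
  reC.comp (((ruelleOp φ).restrictScalars ℝ).comp ofRealC)

variable (φ : C(MarkovSpace A, ℝ)) (f g : C(MarkovSpace A, ℝ))

theorem realOp_apply (x : MarkovSpace A) :
    realOp φ f x = ∑ j : Fin n, if h : A j (x.1 0) = 1 then
      Real.exp (φ (cons j x h)) * f (cons j x h) else 0 := by
  change (ruelleOp φ (ofRealC f) x).re = _
  rw [ruelleOp_apply, Complex.re_sum]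
  refine Finset.sum_congr rfl fun j _ => ?_
  split_ifs
  · rw [ofRealC_apply, ← Complex.ofReal_mul, Complex.ofReal_re]
  · rfl

theorem ruelleOp_ofRealC : ruelleOp φ (ofRealC f) = ofRealC (realOp φ f) := by
  ext x
  rw [ofRealC_apply, realOp_apply, ruelleOp_apply, Complex.ofReal_sum]
  refine Finset.sum_congr rfl fun j _ => ?_
  split_ifs <;> simp

theorem ruelleOp_pow_ofRealC (k : ℕ) :
    (ruelleOp φ ^ k) (ofRealC f) = ofRealC ((realOp φ ^ k) f) := by
  induction k generalizing f with
  | zero => rfl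
  | succ k ih =>
    rw [pow_succ, pow_succ, mul_apply_eq_comp, mul_apply_eq_comp,
      ruelleOp_ofRealC, ih]

variable {f g}

theorem realOp_nonneg (hf : ∀ x, 0 ≤ f x) (x : MarkovSpace A) : 0 ≤ realOp φ f x := by
  rw [realOp_apply]
  refine Finset.sum_nonneg fun j _ => ?_
  split_ifs
  · exact mul_nonneg (Real.exp_pos _).le (hf _)
  · exact le_rfl

theorem realOp_pow_nonneg (hf : ∀ x, 0 ≤ f x) (k : ℕ) :
    ∀ x, 0 ≤ (realOp φ ^ k) f x := by
  induction k with
  | zero => exact hf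
  | succ k ih =>
    rw [pow_succ', mul_apply_eq_comp]
    exact realOp_nonneg φ ih

/-- One inverse branch contributes at most the whole sum when the function is nonnegative. -/
theorem exp_mul_le_realOp (hf : ∀ x, 0 ≤ f x) (x : MarkovSpace A) {j : Fin n}
    (h : A j (x.1 0) = 1) :
    Real.exp (φ (cons j x h)) * f (cons j x h) ≤ realOp φ f x := by
  rw [realOp_apply]
  have h1 := Finset.single_le_sum (s := Finset.univ) (f := fun j : Fin n =>
    if h : A j (x.1 0) = 1 then Real.exp (φ (cons j x h)) * f (cons j x h) else 0)
    (fun i _ => by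
      split_ifs
      · exact mul_nonneg (Real.exp_pos _).le (hf _)
      · exact le_rfl) (Finset.mem_univ j)
  simpa only [dif_pos h] using h1

variable {φ} {r B V : ℝ}

/-- The variation of the potential on cylinders of length `N + 1` is at most `V * r ^ N`. -/
def HasVariation (r V : ℝ) (φ : C(MarkovSpace A, ℝ)) : Prop :=
  ∀ N x y, Agree N x y → φ x - φ y ≤ V * r ^ N

/-- The transfer operator improves the cone parameter from `B` to `(B + V) * r`, since inverse
branches lengthen the common cylinder of two points by one. -/
theorem realOp_mem_logLipCone (hφ : HasVariation r V φ) (hf : f ∈ logLipCone A r B) :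
    realOp φ f ∈ logLipCone A r ((B + V) * r) := by
  refine ⟨realOp_nonneg φ hf.1, fun N x y h => ?_⟩
  rw [realOp_apply, realOp_apply, Finset.mul_sum]
  have h0 : x.1 0 = y.1 0 := h 0 (Nat.zero_le _)
  refine Finset.sum_le_sum fun j _ => ?_
  by_cases hx : A j (x.1 0) = 1
  · have hy : A j (y.1 0) = 1 := h0 ▸ hx
    rw [dif_pos hx, dif_pos hy]
    have hc := h.cons hx hy
    have h1 := hf.2 _ _ _ hc
    have h2 := hφ _ _ _ hc
    have h3 : Real.exp (φ (cons j x hx)) ≤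
        Real.exp (V * r ^ (N + 1)) * Real.exp (φ (cons j y hy)) := by
      rw [← Real.exp_add]
      exact Real.exp_le_exp.2 (by linarith)
    calc Real.exp (φ (cons j x hx)) * f (cons j x hx)
        ≤ (Real.exp (V * r ^ (N + 1)) * Real.exp (φ (cons j y hy))) *
          (Real.exp (B * r ^ (N + 1)) * f (cons j y hy)) :=
          mul_le_mul h3 h1 (hf.1 _) (by positivity)
      _ = (Real.exp (V * r ^ (N + 1)) * Real.exp (B * r ^ (N + 1))) *
          (Real.exp (φ (cons j y hy)) * f (cons j y hy)) := by ring
      _ = _ := by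
        rw [← Real.exp_add]
        congr 2
        ring
  · have hy : ¬ A j (y.1 0) = 1 := h0 ▸ hx
    rw [dif_neg hx, dif_neg hy, mul_zero]

theorem realOp_pow_mem_logLipCone (hφ : HasVariation r V φ) (hr : 0 ≤ r)
    (hB : (B + V) * r ≤ B) (hf : f ∈ logLipCone A r B) (k : ℕ) :
    (realOp φ ^ k) f ∈ logLipCone A r B := by
  induction k with
  | zero => exact hf
  | succ k ih =>
    rw [pow_succ', mul_apply_eq_comp]
    exact logLipCone_mono hr hB (realOp_mem_logLipCone hφ ih)

/-- Following an admissible word of length `k` from the symbol of `z` to the symbol of `x` bounds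
`L ^ k f` at `x` below by `f z`. -/
theorem le_realOp_pow_apply (hA : ∀ i j, A i j = 0 ∨ A i j = 1) (hf : f ∈ logLipCone A r B)
    (z : MarkovSpace A) (k : ℕ) : ∀ x : MarkovSpace A, 0 < (A ^ k) (z.1 0) (x.1 0) →
      Real.exp (-(k * ‖φ‖ + B)) * f z ≤ (realOp φ ^ k) f x := by
  induction k with
  | zero =>
    intro x hx
    have h0 : z.1 0 = x.1 0 := by
      by_contra h
      simp [h] at hx
    have h1 := hf.2 0 z x fun i hi => by
      obtain rfl : i = 0 := by omega
      exact h0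
    rw [pow_zero, mul_one] at h1
    simp only [Nat.cast_zero, zero_mul, zero_add, pow_zero, one_apply_eq_self]
    rwa [Real.exp_neg, inv_mul_le_iff₀ (Real.exp_pos _)]
  | succ k ih =>
    intro x hx
    rw [pow_succ, Matrix.mul_apply] at hx
    obtain ⟨j, -, hj⟩ := Finset.exists_ne_zero_of_sum_ne_zero hx.ne'
    have hj1 : A j (x.1 0) = 1 := (hA _ _).resolve_left (right_ne_zero_of_mul hj)
    have h1 := ih (cons j x hj1) (Nat.pos_of_ne_zero (left_ne_zero_of_mul hj))
    have h2 := exp_mul_le_realOp φ (realOp_pow_nonneg φ hf.1 k) x hj1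
    rw [pow_succ', mul_apply_eq_comp]
    refine le_trans ?_ h2
    have h3 : Real.exp (-‖φ‖) ≤ Real.exp (φ (cons j x hj1)) :=
      Real.exp_le_exp.2 (abs_le.1 (φ.norm_coe_le_norm _)).1
    have h4 : Real.exp (-((k + 1 : ℕ) * ‖φ‖ + B)) =
        Real.exp (-‖φ‖) * Real.exp (-(k * ‖φ‖ + B)) := by
      rw [← Real.exp_add]; congr 1; push_cast; ring
    rw [h4, mul_assoc]
    exact mul_le_mul h3 h1 (mul_nonneg (Real.exp_pos _).le (hf.1 _)) (Real.exp_pos _).le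

/-- The contraction mechanism: after `m` steps, a function `w` of the cone dominates, in the order
given by the cone, a multiple of any other function `v` of the cone, with a uniform constant. -/
theorem exists_gap (hA : ∀ i j, A i j = 0 ∨ A i j = 1) {m : ℕ} (hm : 0 < m)
    (hAm : ∀ i j, 0 < (A ^ m) i j) (hφ : HasVariation r V φ) (hr0 : 0 ≤ r) (hr1 : r ≤ 1)
    (hB0 : 0 ≤ (B + V) * r) (hB : (B + V) * r < B) :
    ∃ δ : ℝ, 0 < δ ∧ ∀ v ∈ logLipCone A r B, ∀ w ∈ logLipCone A r B, ∀ z,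
      ‖v‖ • (realOp φ ^ m) w - (δ * w z) • (realOp φ ^ m) v ∈ logLipCone A r B := by
  set c := Real.exp (-(m * ‖φ‖ + B))
  have hc : 0 < c := Real.exp_pos _
  set D := ‖realOp φ ^ m‖ + 1
  have hD : 0 < D := by positivity
  obtain ⟨δ, hδ, key⟩ := exists_sub_smul_mem_logLipCone (A := A) hr0 hr1 hB0 hB (div_pos hD hc)
  refine ⟨δ, hδ, fun v hv w hw z => ?_⟩
  have hstep : ∀ u ∈ logLipCone A r B, (realOp φ ^ m) u ∈ logLipCone A r ((B + V) * r) := by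
    intro u hu
    obtain ⟨k, rfl⟩ := Nat.exists_eq_succ_of_ne_zero hm.ne'
    rw [pow_succ', mul_apply_eq_comp]
    exact realOp_mem_logLipCone hφ (realOp_pow_mem_logLipCone hφ hr0 hB.le hu k)
  have h := key (w z • (realOp φ ^ m) v) (smul_mem_logLipCone (hw.1 z) (hstep v hv))
    (‖v‖ • (realOp φ ^ m) w) (smul_mem_logLipCone (norm_nonneg _) (hstep w hw)) fun x => by
      have h1 : c * w z ≤ (realOp φ ^ m) w x := le_realOp_pow_apply hA hw z m x (hAm _ _)
      have h2 : (realOp φ ^ m) v x ≤ D * ‖v‖ :=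
        ((le_abs_self _).trans (((realOp φ ^ m) v).norm_coe_le_norm x)).trans
          (((realOp φ ^ m).le_opNorm v).trans (by gcongr; linarith))
      simp only [ContinuousMap.smul_apply, smul_eq_mul]
      calc w z * (realOp φ ^ m) v x ≤ w z * (D * ‖v‖) := mul_le_mul_of_nonneg_left h2 (hw.1 z)
        _ = D / c * (‖v‖ * (c * w z)) := by field_simp
        _ ≤ _ := by gcongr
  rwa [smul_smul] at h

end

section

/-! ### Positive eigenfunctions -/

/-- A bounded operator preserving the cone `logLipCone A r B`, whose power `m` contracts it: any
`w` in the cone dominates after `m` steps, in the order given by the cone, a multiple of any other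
`v` in the cone, and this multiple is proportional to the value of `w` at an arbitrary point `z`,
with a constant `δ` that does not depend on `v`, `w` and `z`. -/
structure IsConeContraction (L : C(MarkovSpace A, ℝ) →L[ℝ] C(MarkovSpace A, ℝ)) (r B : ℝ)
    (m : ℕ) : Prop where
  r_pos : 0 < r
  r_lt_one : r < 1
  B_pos : 0 < B
  m_pos : 0 < m
  nonneg : ∀ f : C(MarkovSpace A, ℝ), (∀ x, 0 ≤ f x) → ∀ x, 0 ≤ L f x
  mem : ∀ f ∈ logLipCone A r B, L f ∈ logLipCone A r B
  pos : ∀ f ∈ logLipCone A r B, ∀ z, 0 < f z → ∀ x, 0 < (L ^ m) f x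
  gap : ∃ δ : ℝ, 0 < δ ∧ ∀ v ∈ logLipCone A r B, ∀ w ∈ logLipCone A r B, ∀ z,
    ‖v‖ • (L ^ m) w - (δ * w z) • (L ^ m) v ∈ logLipCone A r B

namespace IsConeContraction

variable {L : C(MarkovSpace A, ℝ) →L[ℝ] C(MarkovSpace A, ℝ)} {r B : ℝ} {m : ℕ}

theorem pow_nonneg (hL : IsConeContraction L r B m) {f : C(MarkovSpace A, ℝ)}
    (hf : ∀ x, 0 ≤ f x) (k : ℕ) : ∀ x, 0 ≤ (L ^ k) f x := by
  induction k with
  | zero => exact hf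
  | succ k ih =>
    rw [pow_succ', mul_apply_eq_comp]
    exact hL.nonneg _ ih

theorem pow_mem (hL : IsConeContraction L r B m) {f : C(MarkovSpace A, ℝ)}
    (hf : f ∈ logLipCone A r B) (k : ℕ) : (L ^ k) f ∈ logLipCone A r B := by
  induction k with
  | zero => exact hf
  | succ k ih =>
    rw [pow_succ', mul_apply_eq_comp]
    exact hL.mem _ ih

theorem pow_le_pow (hL : IsConeContraction L r B m) {f g : C(MarkovSpace A, ℝ)}
    (hfg : ∀ x, f x ≤ g x) (k : ℕ) (x : MarkovSpace A) : (L ^ k) f x ≤ (L ^ k) g x := by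
  have h := hL.pow_nonneg (f := g - f) (fun x => sub_nonneg.2 (hfg x)) k x
  rw [map_sub] at h
  exact sub_nonneg.1 h

theorem smul (hL : IsConeContraction L r B m) {c : ℝ} (hc : 0 < c) :
    IsConeContraction (c • L) r B m where
  r_pos := hL.r_pos
  r_lt_one := hL.r_lt_one
  B_pos := hL.B_pos
  m_pos := hL.m_pos
  nonneg f hf x := mul_nonneg hc.le (hL.nonneg f hf x)
  mem f hf := smul_mem_logLipCone hc.le (hL.mem f hf)
  pos f hf z hz x := by
    rw [smul_pow]
    exact mul_pos (by positivity) (hL.pos f hf z hz x)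
  gap := by
    obtain ⟨δ, hδ, h⟩ := hL.gap
    refine ⟨δ, hδ, fun v hv w hw z => ?_⟩
    have h1 := smul_mem_logLipCone (by positivity : 0 ≤ c ^ m) (h v hv w hw z)
    rw [smul_sub, smul_comm (c ^ m), smul_comm (c ^ m) (δ * w z)] at h1
    rwa [smul_pow]

/-- An eigenfunction in the cone, found by maximizing `t` over the normalized `f` in the cone for
which `L f - t • f` is in the cone. If `L f - t • f` were nonzero at a maximum, the gap would
allow a larger `t` for `L ^ m f`. -/
theorem exists_eigenfunction [Nonempty (MarkovSpace A)] (hL : IsConeContraction L r B m) :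
    ∃ lam : ℝ, 0 < lam ∧ ∃ h ∈ logLipCone A r B, (∀ x, 0 < h x) ∧ L h = lam • h := by
  obtain ⟨x₀⟩ := ‹Nonempty (MarkovSpace A)›
  set S : Set (ℝ × C(MarkovSpace A, ℝ)) := {p | p.2 ∈ logLipCone A r B ∩ Metric.sphere 0 1 ∧
    0 ≤ p.1 ∧ L p.2 - p.1 • p.2 ∈ logLipCone A r B}
  have exists_pos : ∀ f ∈ logLipCone A r B, f ≠ 0 → ∃ z, 0 < f z := by
    intro f hf h0
    by_contra! h
    exact h0 (ContinuousMap.ext fun x => le_antisymm (h x) (hf.1 x))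
  have hcomp : IsCompact S := by
    refine ((isCompact_Icc (a := 0) (b := ‖L‖)).prod (isCompact_logLipCone_inter_sphere
      (A := A) (B := B) hL.r_pos.le hL.r_lt_one)).of_isClosed_subset ?_ ?_
    · refine IsClosed.inter (((isClosed_logLipCone r B).inter
        Metric.isClosed_sphere).preimage continuous_snd)
        (IsClosed.inter (isClosed_le continuous_const continuous_fst)
        ((isClosed_logLipCone r B).preimage ?_))
      exact (L.continuous.comp continuous_snd).sub (continuous_fst.smul continuous_snd)
    · rintro ⟨t, f⟩ ⟨hf, ht, htf⟩
      refine ⟨⟨ht, ?_⟩, hf⟩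
      have hf1 : ‖f‖ = 1 := by simpa using hf.2
      have h1 : ‖t • f‖ ≤ ‖L f‖ := by
        refine (ContinuousMap.norm_le _ (norm_nonneg _)).2 fun x => ?_
        have h2 : t * f x ≤ L f x := sub_nonneg.1 (htf.1 x)
        have h3 : 0 ≤ t * f x := mul_nonneg ht (hf.1.1 x)
        rw [ContinuousMap.smul_apply, smul_eq_mul, Real.norm_of_nonneg h3]
        exact (h2.trans (le_abs_self _)).trans ((L f).norm_coe_le_norm x)
      have h4 := h1.trans (L.le_opNorm f)
      rwa [norm_smul, hf1, mul_one, mul_one, Real.norm_of_nonneg ht] at h4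
  have hne : S.Nonempty := by
    have h1 := one_mem_logLipCone (A := A) hL.r_pos.le hL.B_pos.le
    have : Nonempty (MarkovSpace A) := ⟨x₀⟩
    refine ⟨(0, 1), ⟨h1, by simp⟩, le_rfl, ?_⟩
    simpa using hL.mem _ h1
  obtain ⟨⟨lam, h⟩, ⟨⟨hK, hnorm⟩, hlam, hsub⟩, hmax⟩ :=
    hcomp.exists_isMaxOn hne continuous_fst.continuousOn
  have hnorm1 : ‖h‖ = 1 := by simpa using hnorm
  have hh0 : h ≠ 0 := by
    rintro rfl
    simp at hnorm1
  obtain ⟨y, hy⟩ := exists_pos h hK hh0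
  have hpos := hL.pos h hK y hy
  have heig : L h - lam • h = 0 := by
    by_contra hw
    obtain ⟨z, hz⟩ := exists_pos _ hsub hw
    obtain ⟨δ, hδ, hgap⟩ := hL.gap
    have h1 := hgap h hK _ hsub z
    simp only at hz
    set w := L h - lam • h with hwdef
    set g := (L ^ m) h with hg
    have hLw : (L ^ m) w = L g - lam • g := by
      rw [hwdef, map_sub, map_smul, hg, ← mul_apply_eq_comp, ← mul_apply_eq_comp,
        ← pow_succ, ← pow_succ']
    have hgpos : 0 < ‖g‖ := by
      rw [norm_pos_iff]
      intro h0
      have := hpos x₀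
      rw [h0] at this
      exact lt_irrefl _ this
    have hmem : (lam + δ * w z, ‖g‖⁻¹ • g) ∈ S := by
      refine ⟨⟨smul_mem_logLipCone (by positivity) (hL.pow_mem hK m), ?_⟩, ?_, ?_⟩
      · simp [norm_smul, hgpos.ne']
      · have := mul_pos hδ hz
        simp only
        linarith
      · have h2 := smul_mem_logLipCone (inv_nonneg.2 hgpos.le) h1
        rw [hnorm1, one_smul, hLw] at h2
        convert h2 using 1
        simp only [map_smul]
        module
    have h3 : lam + δ * w z ≤ lam := hmax hmem
    linarith [mul_pos hδ hz]
  have heig' : L h = lam • h := sub_eq_zero.1 heig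
  have hpow : ∀ k : ℕ, (L ^ k) h = lam ^ k • h := by
    intro k
    induction k with
    | zero => simp
    | succ k ih => rw [pow_succ', mul_apply_eq_comp, ih, map_smul, heig', smul_smul, pow_succ]
  have hpos' : ∀ x, 0 < lam ^ m * h x := fun x => by
    have := hpos x
    rwa [hpow] at this
  have hlampos : 0 < lam := by
    refine lt_of_le_of_ne hlam fun h0 => ?_
    have h1 := hpos' x₀
    rw [← h0, zero_pow hL.m_pos.ne', zero_mul] at h1
    exact lt_irrefl _ h1
  exact ⟨lam, hlampos, h, hK, fun x => pos_of_mul_pos_right (hpos' x) (by positivity), heig'⟩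

end IsConeContraction

/-! ### Convergence of the normalized iterates -/

/-- The iterates of `T` on `g` become, up to an arbitrarily small relative error, constant
multiples of `h`. -/
def IsAsymptotic (T : C(MarkovSpace A, ℝ) →L[ℝ] C(MarkovSpace A, ℝ)) (h g : C(MarkovSpace A, ℝ)) :
    Prop :=
  ∀ ε > 0, ∃ (a : ℝ) (k₀ : ℕ), ∀ k ≥ k₀, ∀ x, |(T ^ k) g x - a * h x| ≤ ε * h x

variable {r B : ℝ} {m : ℕ} {T : C(MarkovSpace A, ℝ) →L[ℝ] C(MarkovSpace A, ℝ)}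
  {f g h : C(MarkovSpace A, ℝ)}

theorem IsAsymptotic.sub (hf : IsAsymptotic T h f) (hg : IsAsymptotic T h g) :
    IsAsymptotic T h (f - g) := by
  intro ε hε
  obtain ⟨a, k, ha⟩ := hf (ε / 2) (half_pos hε)
  obtain ⟨b, l, hb⟩ := hg (ε / 2) (half_pos hε)
  refine ⟨a - b, max k l, fun i hi x => ?_⟩
  have h1 := abs_le.1 (ha i (le_of_max_le_left hi) x)
  have h2 := abs_le.1 (hb i (le_of_max_le_right hi) x)
  rw [map_sub, ContinuousMap.sub_apply, abs_le]
  constructor <;> linarith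

/-- Continuous functions that depend on finitely many coordinates are dense. -/
theorem exists_agree_norm_sub_lt (g : C(MarkovSpace A, ℝ)) {ε : ℝ}
    (hε : 0 < ε) : ∃ (f : C(MarkovSpace A, ℝ)) (p : ℕ),
      (∀ x y, Agree p x y → f x = f y) ∧ ‖g - f‖ < ε := by
  let c : ℕ → C(MarkovSpace A, ℝ) := fun i =>
    ⟨fun x => ((x.1 i : ℕ) : ℝ), by
      have h1 : Continuous fun x : MarkovSpace A => x.1 i :=
        (continuous_apply i).comp continuous_subtype_val
      exact (continuous_of_discreteTopology (f := fun j : Fin n => ((j : ℕ) : ℝ))).comp h1⟩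
  let 𝒜 : Subalgebra ℝ C(MarkovSpace A, ℝ) := Algebra.adjoin ℝ (Set.range c)
  have hsep : 𝒜.SeparatesPoints := by
    intro x y hxy
    have h1 : ∃ i, x.1 i ≠ y.1 i := by
      by_contra! h
      exact hxy (Subtype.ext (funext h))
    obtain ⟨i, hi⟩ := h1
    refine ⟨c i, ⟨c i, Algebra.subset_adjoin ⟨i, rfl⟩, rfl⟩, fun h => hi ?_⟩
    have h2 : ((x.1 i : ℕ) : ℝ) = ((y.1 i : ℕ) : ℝ) := h
    exact Fin.ext (by exact_mod_cast h2)
  have hdense := ContinuousMap.subalgebra_topologicalClosure_eq_top_of_separatesPoints 𝒜 hsep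
  have hg : g ∈ closure (𝒜 : Set C(MarkovSpace A, ℝ)) := by
    rw [← Subalgebra.topologicalClosure_coe, hdense]
    trivial
  obtain ⟨f, hf, hgf⟩ := Metric.mem_closure_iff.1 hg ε hε
  have hloc : ∃ p : ℕ, ∀ x y, Agree p x y → f x = f y := by
    refine Algebra.adjoin_induction (p := fun f _ => ∃ p : ℕ, ∀ x y, Agree p x y → f x = f y)
      ?_ ?_ ?_ ?_ hf
    · rintro _ ⟨i, rfl⟩
      refine ⟨i, fun x y h => ?_⟩
      change ((x.1 i : ℕ) : ℝ) = ((y.1 i : ℕ) : ℝ)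
      rw [h i le_rfl]
    · exact fun c => ⟨0, fun x y _ => rfl⟩
    · rintro f g - - ⟨p, hp⟩ ⟨q, hq⟩
      refine ⟨max p q, fun x y h => ?_⟩
      rw [ContinuousMap.add_apply, ContinuousMap.add_apply,
        hp x y fun i hi => h i (le_max_of_le_left hi),
        hq x y fun i hi => h i (le_max_of_le_right hi)]
    · rintro f g - - ⟨p, hp⟩ ⟨q, hq⟩
      refine ⟨max p q, fun x y h => ?_⟩
      rw [ContinuousMap.mul_apply, ContinuousMap.mul_apply,
        hp x y fun i hi => h i (le_max_of_le_left hi),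
        hq x y fun i hi => h i (le_max_of_le_right hi)]
  obtain ⟨p, hp⟩ := hloc
  exact ⟨f, p, hp, by rwa [← dist_eq_norm]⟩

theorem exists_pos_forall_le [Nonempty (MarkovSpace A)]
    (hpos : ∀ x, 0 < h x) : ∃ c : ℝ, 0 < c ∧ ∀ x, c ≤ h x := by
  obtain ⟨x, -, hx⟩ := isCompact_univ.exists_isMinOn Set.univ_nonempty h.continuous.continuousOn
  exact ⟨h x, hpos x, fun y => hx (Set.mem_univ y)⟩

namespace IsConeContraction

theorem pow_apply_eq_self (hTh : T h = h) (k : ℕ) : (T ^ k) h = h := by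
  induction k with
  | zero => rfl
  | succ k ih => rw [pow_succ, mul_apply_eq_comp, hTh, ih]

/-- Every `m` steps the interval `[a, b]` with `a • h ≤ T ^ k u ≤ b • h`, in the order given by the
cone, shrinks by a fixed factor `ρ < 1`. -/
theorem exists_sandwich (hT : IsConeContraction T r B m) (hK : h ∈ logLipCone A r B)
    (hpos : ∀ x, 0 < h x) (hTh : T h = h) (z : MarkovSpace A) {u : C(MarkovSpace A, ℝ)}
    (hu : u ∈ logLipCone A r B) :
    ∃ C ρ : ℝ, 0 ≤ ρ ∧ ρ < 1 ∧ ∀ k : ℕ, ∃ a b : ℝ, b - a = C * ρ ^ k ∧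
      (T ^ (m * (k + 1))) u - a • h ∈ logLipCone A r B ∧
      b • h - (T ^ (m * (k + 1))) u ∈ logLipCone A r B := by
  obtain ⟨δ, hδ, hgap⟩ := hT.gap
  have hTm := pow_apply_eq_self hTh m
  have hn : 0 < ‖h‖ := norm_pos_iff.2 fun h0 => by
    have := hpos z
    rw [h0] at this
    exact lt_irrefl _ this
  have hz := hpos z
  set η := δ / ‖h‖ with hη
  have hη0 : 0 < η := div_pos hδ hn
  have hstep : ∀ w ∈ logLipCone A r B, (T ^ m) w - (η * w z) • h ∈ logLipCone A r B := by
    intro w hw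
    have h1 := smul_mem_logLipCone (inv_nonneg.2 hn.le) (hgap h hK w hw z)
    rw [hTm, smul_sub, smul_smul, smul_smul, inv_mul_cancel₀ hn.ne', one_smul] at h1
    convert h1 using 3
    rw [hη]
    ring
  have hρ : 0 ≤ 1 - η * h z := by
    have h1 := (hstep h hK).1 z
    rw [hTm, ContinuousMap.sub_apply, ContinuousMap.smul_apply, smul_eq_mul] at h1
    have h2 : 0 ≤ (1 - η * h z) * h z := by linarith
    exact nonneg_of_mul_nonneg_left h2 hz
  refine ⟨‖u‖ / (δ * h z), 1 - η * h z, hρ, by linarith [mul_pos hη0 hz], fun k => ?_⟩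
  induction k with
  | zero =>
    refine ⟨0, ‖u‖ / (δ * h z), by simp, ?_, ?_⟩
    · simpa using hT.pow_mem hu m
    · have hd : 0 < δ * h z := mul_pos hδ hz
      have h1 := smul_mem_logLipCone (inv_nonneg.2 hd.le) (hgap u hu h hK z)
      rw [hTm, smul_sub, smul_smul, smul_smul, inv_mul_cancel₀ hd.ne', one_smul] at h1
      rw [zero_add, mul_one]
      convert h1 using 3
      ring
  | succ k ih =>
    obtain ⟨a, b, hab, ha, hb⟩ := ih
    set U := (T ^ (m * (k + 1))) u with hU
    have hTU : (T ^ (m * (k + 1 + 1))) u = (T ^ m) U := by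
      rw [hU, ← mul_apply_eq_comp, ← pow_add]
      congr 2
      ring
    refine ⟨a + η * (U - a • h) z, b - η * (b • h - U) z, ?_, ?_, ?_⟩
    · rw [pow_succ, ← mul_assoc, ← hab]
      simp only [ContinuousMap.sub_apply, ContinuousMap.smul_apply, smul_eq_mul]
      ring
    · have h1 := hstep _ ha
      rw [map_sub, map_smul, hTm] at h1
      rw [hTU]
      convert h1 using 1
      module
    · have h1 := hstep _ hb
      rw [map_sub, map_smul, hTm] at h1
      rw [hTU]
      convert h1 using 1
      module

theorem isAsymptotic_of_mem (hT : IsConeContraction T r B m) (hK : h ∈ logLipCone A r B)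
    (hpos : ∀ x, 0 < h x) (hTh : T h = h) (hf : f ∈ logLipCone A r B) : IsAsymptotic T h f := by
  intro ε hε
  rcases isEmpty_or_nonempty (MarkovSpace A) with hX | ⟨⟨z⟩⟩
  · exact ⟨0, 0, fun k _ x => hX.elim x⟩
  obtain ⟨C, ρ, hρ0, hρ1, H⟩ := hT.exists_sandwich hK hpos hTh z hf
  have hlim : Tendsto (fun k : ℕ => C * ρ ^ k) atTop (𝓝 0) := by
    simpa using (tendsto_pow_atTop_nhds_zero_of_lt_one hρ0 hρ1).const_mul C
  obtain ⟨k, hk⟩ := (hlim.eventually (gt_mem_nhds hε)).exists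
  obtain ⟨a, b, hab, ha, hb⟩ := H k
  refine ⟨a, m * (k + 1), fun l hl x => ?_⟩
  obtain ⟨j, rfl⟩ := Nat.exists_eq_add_of_le hl
  have h1 := hT.pow_nonneg ha.1 j x
  have h2 := hT.pow_nonneg hb.1 j x
  rw [map_sub, map_smul, pow_apply_eq_self hTh, ← mul_apply_eq_comp, ← pow_add,
    add_comm j] at h1 h2
  simp only [ContinuousMap.sub_apply, ContinuousMap.smul_apply, smul_eq_mul] at h1 h2
  have h3 : (b - a) * h x ≤ ε * h x := by
    rw [hab]
    exact mul_le_mul_of_nonneg_right hk.le (hpos x).le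
  rw [abs_le]
  constructor <;> linarith [hpos x, mul_pos hε (hpos x)]

theorem isAsymptotic [Nonempty (MarkovSpace A)] (hT : IsConeContraction T r B m)
    (hK : h ∈ logLipCone A r B) (hpos : ∀ x, 0 < h x) (hTh : T h = h)
    (g : C(MarkovSpace A, ℝ)) : IsAsymptotic T h g := by
  have hloc : ∀ (f : C(MarkovSpace A, ℝ)) (p : ℕ), (∀ x y, Agree p x y → f x = f y) →
      IsAsymptotic T h f := by
    intro f p hf
    obtain ⟨c, hc, hfc⟩ := exists_add_const_mem_logLipCone hT.r_pos hT.r_lt_one.le hT.B_pos hf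
    have h1 := smul_mem_logLipCone hc (one_mem_logLipCone (A := A) hT.r_pos.le hT.B_pos.le)
    simpa using (hT.isAsymptotic_of_mem hK hpos hTh hfc).sub
      (hT.isAsymptotic_of_mem hK hpos hTh h1)
  intro ε hε
  obtain ⟨c, hc, hch⟩ := exists_pos_forall_le hpos
  obtain ⟨f, p, hf, hgf⟩ := exists_agree_norm_sub_lt g (by positivity : 0 < ε / 2 * c)
  obtain ⟨a, k₀, ha⟩ := hloc f p hf (ε / 2) (half_pos hε)
  have hbound : ∀ x, |g x - f x| ≤ ε / 2 * h x := fun x =>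
    ((g - f).norm_coe_le_norm x).trans (hgf.le.trans (by gcongr; exact hch x))
  refine ⟨a, k₀, fun k hk x => ?_⟩
  have hup := hT.pow_le_pow (f := g - f) (g := (ε / 2) • h)
    (fun x => (abs_le.1 (hbound x)).2) k x
  have hlow := hT.pow_le_pow (f := -((ε / 2) • h)) (g := g - f)
    (fun x => (abs_le.1 (hbound x)).1) k x
  rw [map_neg] at hlow
  rw [map_sub, map_smul, pow_apply_eq_self hTh] at hup hlow
  simp only [ContinuousMap.sub_apply, ContinuousMap.neg_apply, ContinuousMap.smul_apply,
    smul_eq_mul] at hup hlow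
  have h1 := abs_le.1 (ha k hk x)
  rw [abs_le]
  constructor <;> linarith

/-- The normalized iterates of every continuous function converge to a multiple of `h`. -/
theorem exists_tendsto [Nonempty (MarkovSpace A)] (hT : IsConeContraction T r B m)
    (hK : h ∈ logLipCone A r B) (hpos : ∀ x, 0 < h x) (hTh : T h = h)
    (g : C(MarkovSpace A, ℝ)) : ∃ l : ℝ, Tendsto (fun k => (T ^ k) g) atTop (𝓝 (l • h)) := by
  have hasym := hT.isAsymptotic hK hpos hTh g
  obtain ⟨z⟩ := ‹Nonempty (MarkovSpace A)›
  have hz := hpos z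
  -- the limit is read off at the point `z`
  have hcauchy : CauchySeq fun k => (T ^ k) g z / h z := by
    rw [Metric.cauchySeq_iff']
    intro ε hε
    obtain ⟨a, k₀, ha⟩ := hasym (ε / 3) (by positivity)
    refine ⟨k₀, fun k hk => ?_⟩
    have h1 := abs_le.1 (ha k hk z)
    have h2 := abs_le.1 (ha k₀ le_rfl z)
    rw [Real.dist_eq, ← sub_div, abs_div, abs_of_pos hz, div_lt_iff₀ hz, abs_lt]
    constructor <;> nlinarith
  obtain ⟨l, hl⟩ := cauchySeq_tendsto_of_complete hcauchy
  refine ⟨l, ?_⟩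
  rw [Metric.tendsto_atTop]
  intro ε hε
  have hn : 0 < ‖h‖ + 1 := by positivity
  set η := ε / (3 * (‖h‖ + 1)) with hη
  have hη0 : 0 < η := by positivity
  obtain ⟨a, k₀, ha⟩ := hasym η hη0
  have hla : |l - a| ≤ η := by
    refine le_of_tendsto ((hl.sub_const a).abs) ?_
    filter_upwards [eventually_ge_atTop k₀] with k hk
    rw [show (T ^ k) g z / h z - a = ((T ^ k) g z - a * h z) / h z by field_simp, abs_div,
      abs_of_pos hz, div_le_iff₀ hz]
    exact ha k hk z
  refine ⟨k₀, fun k hk => ?_⟩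
  have hle : dist ((T ^ k) g) (l • h) ≤ 2 * η * (‖h‖ + 1) := by
    refine (ContinuousMap.dist_le (by positivity)).2 fun x => ?_
    have h1 := abs_le.1 (ha k hk x)
    have h2 := abs_le.1 hla
    have h3 := hpos x
    have h4 : h x ≤ ‖h‖ + 1 :=
      ((le_abs_self _).trans (h.norm_coe_le_norm x)).trans (by linarith)
    have h5 : |(T ^ k) g x - l * h x| ≤ 2 * η * h x := by
      rw [abs_le]
      constructor <;> nlinarith
    rw [Real.dist_eq, ContinuousMap.smul_apply, smul_eq_mul]
    exact h5.trans (by gcongr)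
  refine hle.trans_lt ?_
  have : 2 * η * (‖h‖ + 1) = 2 * ε / 3 := by
    rw [hη]
    field_simp
  linarith

end IsConeContraction

end

section

/-! ### The eigenmeasure -/

theorem continuousMap_integrable {E : Type*} [NormedAddCommGroup E] [SecondCountableTopology E]
    (ν : Measure (MarkovSpace A)) [IsFiniteMeasure ν] (f : C(MarkovSpace A, E)) :
    Integrable f ν :=
  f.continuous.integrable_of_hasCompactSupport (HasCompactSupport.of_compactSpace f)

/-- The limits of the normalized iterates, as multiples of `h`, form a positive linear functional;
the Riesz representation theorem turns it into a probability measure after rescaling `h`. -/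
theorem IsConeContraction.exists_measure [Nonempty (MarkovSpace A)]
    {T : C(MarkovSpace A, ℝ) →L[ℝ] C(MarkovSpace A, ℝ)} {h : C(MarkovSpace A, ℝ)} {r B : ℝ}
    {m : ℕ} (hT : IsConeContraction T r B m) (hK : h ∈ logLipCone A r B)
    (hpos : ∀ x, 0 < h x) (hTh : T h = h) :
    ∃ (c : ℝ) (ν : Measure (MarkovSpace A)), 0 < c ∧ IsProbabilityMeasure ν ∧
      ∀ g : C(MarkovSpace A, ℝ),
        Tendsto (fun k => (T ^ k) g) atTop (𝓝 ((∫ x, g x ∂ν) • (c • h))) := by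
  obtain ⟨z⟩ := id ‹Nonempty (MarkovSpace A)›
  choose F hF using hT.exists_tendsto hK hpos hTh
  have huniq : ∀ (g : C(MarkovSpace A, ℝ)) (l : ℝ),
      Tendsto (fun k => (T ^ k) g) atTop (𝓝 (l • h)) → F g = l := by
    intro g l hl
    have h1 := DFunLike.congr_fun (tendsto_nhds_unique (hF g) hl) z
    exact mul_right_cancel₀ (hpos z).ne' h1
  have hadd : ∀ f g, F (f + g) = F f + F g := fun f g => huniq _ _ <| by
    simpa only [map_add, add_smul] using (hF f).add (hF g)
  have hsmul : ∀ (a : ℝ) f, F (a • f) = a * F f := fun a f => huniq _ _ <| by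
    simpa only [map_smul, mul_smul] using (hF f).const_smul a
  have hle : ∀ f : C(MarkovSpace A, ℝ), (∀ x, 0 ≤ f x) → 0 ≤ F f := by
    intro f hf
    have h1 : Tendsto (fun k => (T ^ k) f z) atTop (𝓝 (F f * h z)) :=
      ((ContinuousEvalConst.continuous_eval_const z).tendsto _).comp (hF f)
    exact nonneg_of_mul_nonneg_left (ge_of_tendsto' h1 fun k => hT.pow_nonneg hf k z) (hpos z)
  have hFh : F h = 1 := huniq _ _ <| by
    simp only [one_smul, IsConeContraction.pow_apply_eq_self hTh]
    exact tendsto_const_nhds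
  have hF1 : 0 < F 1 := by
    have h1 := hle (‖h‖ • 1 - h) fun x => by
      simpa using (le_abs_self _).trans (h.norm_coe_le_norm x)
    rw [sub_eq_add_neg, ← neg_one_smul ℝ h, hadd, hsmul, hsmul, hFh] at h1
    by_contra! h2
    nlinarith [norm_nonneg h]
  let Λ : CompactlySupportedContinuousMap (MarkovSpace A) ℝ →ₚ[ℝ] ℝ :=
    PositiveLinearMap.mk₀
      { toFun := fun f => F f.toContinuousMap / F 1
        map_add' := fun f g => by
          rw [← add_div, ← hadd]
          rfl
        map_smul' := fun a f => by
          rw [RingHom.id_apply, smul_eq_mul, ← mul_div_assoc, ← hsmul]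
          rfl }
      fun f hf => div_nonneg (hle _ fun x => hf x) hF1.le
  have hint : ∀ g : C(MarkovSpace A, ℝ), ∫ x, g x ∂(RealRMK.rieszMeasure Λ) = F g / F 1 :=
    fun g => RealRMK.integral_rieszMeasure Λ
      (CompactlySupportedContinuousMap.continuousMapEquiv g)
  refine ⟨F 1, RealRMK.rieszMeasure Λ, hF1, ⟨?_⟩, fun g => ?_⟩
  · have h1 := hint 1
    rw [div_self hF1.ne'] at h1
    simp only [ContinuousMap.one_apply, integral_const, smul_eq_mul, mul_one] at h1
    exact (ENNReal.toReal_eq_one_iff _).1 h1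
  · rw [hint, smul_smul, div_mul_cancel₀ _ hF1.ne']
    exact hF g

/-! ### Ruelle's theorem -/

theorem integral_ofRealC (ν : Measure (MarkovSpace A)) (f : C(MarkovSpace A, ℝ)) :
    ∫ x, ofRealC f x ∂ν = ((∫ x, f x ∂ν : ℝ) : ℂ) :=
  integral_ofReal

theorem integral_eq_re_add_im (ν : Measure (MarkovSpace A)) [IsFiniteMeasure ν]
    (f : C(MarkovSpace A, ℂ)) :
    ∫ x, f x ∂ν = ((∫ x, reC f x ∂ν : ℝ) : ℂ) + Complex.I * ((∫ x, imC f x ∂ν : ℝ) : ℂ) := by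
  conv_lhs => rw [← ofRealC_re_add_im f]
  simp only [ContinuousMap.add_apply, ContinuousMap.smul_apply, smul_eq_mul]
  rw [integral_add (continuousMap_integrable ν _)
    ((continuousMap_integrable ν (ofRealC (imC f))).const_mul _), integral_const_mul,
    integral_ofRealC, integral_ofRealC]

theorem nonempty_of_primitive (hn : 0 < n) (hA : ∀ i j, A i j = 0 ∨ A i j = 1) {m : ℕ}
    (hm : 0 < m) (hAm : ∀ i j, 0 < (A ^ m) i j) : Nonempty (MarkovSpace A) := by
  have hex : ∀ i, ∃ j, A i j = 1 := by
    intro i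
    obtain ⟨k, rfl⟩ := Nat.exists_eq_succ_of_ne_zero hm.ne'
    have h1 := hAm i i
    rw [pow_succ', Matrix.mul_apply] at h1
    obtain ⟨j, -, hj⟩ := Finset.exists_ne_zero_of_sum_ne_zero h1.ne'
    exact ⟨j, (hA _ _).resolve_left (left_ne_zero_of_mul hj)⟩
  choose s hs using hex
  refine ⟨⟨fun i => s^[i] ⟨0, hn⟩, fun i => ?_⟩⟩
  change A (s^[i] ⟨0, hn⟩) (s^[i + 1] ⟨0, hn⟩) = 1
  rw [Function.iterate_succ_apply']
  exact hs _

variable {φ ψ : C(MarkovSpace A, ℝ)}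

theorem isConeContraction_realOp {r V : ℝ} (hA : ∀ i j, A i j = 0 ∨ A i j = 1) {m : ℕ}
    (hm : 0 < m) (hAm : ∀ i j, 0 < (A ^ m) i j) (hr0 : 0 < r) (hr1 : r < 1) (hV : 0 ≤ V)
    (hφ : HasVariation r V φ) : IsConeContraction (realOp φ) r (V * r / (1 - r) + 1) m := by
  -- this value of `B` exceeds the fixed point `V * r / (1 - r)` of `B ↦ (B + V) * r`
  have h1r : 0 < 1 - r := sub_pos.2 hr1
  have hB : (V * r / (1 - r) + 1 + V) * r < V * r / (1 - r) + 1 := by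
    have h1 : V * r / (1 - r) * (1 - r) = V * r := div_mul_cancel₀ _ h1r.ne'
    nlinarith
  exact
    { r_pos := hr0
      r_lt_one := hr1
      B_pos := by positivity
      m_pos := hm
      nonneg := fun f hf => realOp_nonneg φ hf
      mem := fun f hf => logLipCone_mono hr0.le hB.le (realOp_mem_logLipCone hφ hf)
      pos := fun f hf z hz x => (mul_pos (Real.exp_pos _) hz).trans_le
        (le_realOp_pow_apply hA hf z m x (hAm _ _))
      gap := exists_gap hA hm hAm hφ hr0.le hr1.le (by positivity) hB }

/-- Ruelle's Perron-Frobenius theorem. -/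
theorem exists_isRuelleEigenvalue {r V : ℝ} (hn : 0 < n) (hA : ∀ i j, A i j = 0 ∨ A i j = 1)
    {m : ℕ} (hm : 0 < m) (hAm : ∀ i j, 0 < (A ^ m) i j) (hr0 : 0 < r) (hr1 : r < 1)
    (hV : 0 ≤ V) (hφ : HasVariation r V φ) : ∃ lam : ℝ, IsRuelleEigenvalue φ lam := by
  have hne := nonempty_of_primitive hn hA hm hAm
  have hL := isConeContraction_realOp hA hm hAm hr0 hr1 hV hφ
  obtain ⟨lam, hlam, h, hK, hpos, heig⟩ := hL.exists_eigenfunction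
  have hT := hL.smul (inv_pos.2 hlam)
  set T := lam⁻¹ • realOp φ with hTdef
  have hTh : T h = h := by
    rw [hTdef, smul_apply, heig, smul_smul, inv_mul_cancel₀ hlam.ne',
      one_smul]
  obtain ⟨c, ν, hc, hν, hlim⟩ := hT.exists_measure hK hpos hTh
  obtain ⟨z⟩ := id hne
  have hreal : ∀ g : C(MarkovSpace A, ℝ),
      ∫ x, realOp φ g x ∂ν = lam * ∫ x, g x ∂ν := by
    intro g
    have h1 : Tendsto (fun k => (T ^ k) (T g)) atTop (𝓝 ((∫ x, g x ∂ν) • (c • h))) :=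
      (hlim g).comp (tendsto_add_atTop_nat 1)
    have h2 := DFunLike.congr_fun (tendsto_nhds_unique (hlim (T g)) h1) z
    have h3 : ∫ x, T g x ∂ν = ∫ x, g x ∂ν :=
      mul_right_cancel₀ (mul_pos hc (hpos z)).ne' h2
    have h4 : ∫ x, T g x ∂ν = lam⁻¹ * ∫ x, realOp φ g x ∂ν := integral_const_mul _ _
    rw [← h3, h4, mul_inv_cancel_left₀ hlam.ne']
  refine ⟨lam, hlam, ofRealC (c • h), ν, fun x => ?_, hν, ?_, fun f => ?_, fun g => ?_⟩
  · rw [ofRealC_apply, Complex.zero_lt_real]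
    exact mul_pos hc (hpos x)
  · rw [ruelleOp_ofRealC, map_smul, heig]
    ext x
    simp
    ring
  · have h1 : ruelleOp φ f = ofRealC (realOp φ (reC f)) +
        Complex.I • ofRealC (realOp φ (imC f)) := by
      rw [← ruelleOp_ofRealC, ← ruelleOp_ofRealC, ← map_smul, ← map_add, ofRealC_re_add_im]
    have h2 : reC (ruelleOp φ f) = realOp φ (reC f) := by
      ext x
      simp [h1]
    have h3 : imC (ruelleOp φ f) = realOp φ (imC f) := by
      ext x
      simp [h1]
    rw [integral_eq_re_add_im, h2, h3, hreal, hreal, integral_eq_re_add_im ν f]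
    push_cast
    ring
  · rw [← tendsto_iff_norm_sub_tendsto_zero]
    have h1 : ∀ (k : ℕ) (f : C(MarkovSpace A, ℝ)),
        ((lam : ℂ) ^ k)⁻¹ • (ruelleOp φ ^ k) (ofRealC f) = ofRealC ((T ^ k) f) := by
      intro k f
      rw [ruelleOp_pow_ofRealC, hTdef, smul_pow]
      ext x
      simp
    have h2 : ∀ k : ℕ, ((lam : ℂ) ^ k)⁻¹ • (ruelleOp φ ^ k) g =
        ofRealC ((T ^ k) (reC g)) + Complex.I • ofRealC ((T ^ k) (imC g)) := by
      intro k
      conv_lhs => rw [← ofRealC_re_add_im g]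
      rw [map_add, map_smul, smul_add, smul_comm _ Complex.I, h1, h1]
    have h3 := ((ofRealC (A := A).continuous.tendsto _).comp (hlim (reC g))).add
      (((ofRealC (A := A).continuous.tendsto _).comp (hlim (imC g))).const_smul Complex.I)
    have h4 : (∫ x, g x ∂ν) • ofRealC (c • h) = ofRealC ((∫ x, reC g x ∂ν) • c • h) +
        Complex.I • ofRealC ((∫ x, imC g x ∂ν) • c • h) := by
      rw [integral_eq_re_add_im]
      ext x
      simp
      ring
    rw [h4, funext h2]
    exact h3

/-! ### Comparison of eigenvalues -/

theorem integral_realOp_of_integral_ruelleOp {ν : Measure (MarkovSpace A)} {lam : ℝ}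
    (h : ∀ f : C(MarkovSpace A, ℂ), ∫ x, ruelleOp φ f x ∂ν = (lam : ℂ) * ∫ x, f x ∂ν)
    (f : C(MarkovSpace A, ℝ)) : ∫ x, realOp φ f x ∂ν = lam * ∫ x, f x ∂ν := by
  have h1 := h (ofRealC f)
  rw [ruelleOp_ofRealC, integral_ofRealC, integral_ofRealC] at h1
  exact_mod_cast h1

/-- Eigenvalues are monotone in the potential: integrate the eigenfunction of `ψ` against the
eigenmeasure of `φ`. -/
theorem IsRuelleEigenvalue.le_exp_mul {a b t : ℝ} (hφ : IsRuelleEigenvalue φ a)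
    (hψ : IsRuelleEigenvalue ψ b) (hle : ∀ x, ψ x ≤ φ x + t) : b ≤ Real.exp t * a := by
  obtain ⟨-, -, ν, -, hν, -, hint, -⟩ := hφ
  obtain ⟨-, h, -, hpos, -, heig, -, -⟩ := hψ
  set k := reC h with hk
  have hkpos : ∀ x, 0 < k x := fun x => (Complex.pos_iff.1 (hpos x)).1
  have hhk : ofRealC k = h := by
    ext x
    exact Complex.ext rfl (Complex.pos_iff.1 (hpos x)).2
  have heig' : ∀ x, realOp ψ k x = b * k x := by
    intro x
    have h1 := DFunLike.congr_fun heig x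
    rw [← hhk, ruelleOp_ofRealC] at h1
    simp only [ofRealC_apply, ContinuousMap.smul_apply, smul_eq_mul] at h1
    exact_mod_cast h1
  have hop : ∀ x, realOp ψ k x ≤ Real.exp t * realOp φ k x := by
    intro x
    rw [realOp_apply, realOp_apply, Finset.mul_sum]
    refine Finset.sum_le_sum fun j _ => ?_
    split_ifs with hj
    · rw [← mul_assoc, ← Real.exp_add]
      have := hle (cons j x hj)
      exact mul_le_mul_of_nonneg_right (Real.exp_le_exp.2 (by linarith)) (hkpos _).le
    · rw [mul_zero]
  have h1 : ∫ x, b * k x ∂ν ≤ ∫ x, Real.exp t * realOp φ k x ∂ν :=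
    integral_mono ((continuousMap_integrable ν k).const_mul b)
      ((continuousMap_integrable ν (realOp φ k)).const_mul _)
      fun x => (heig' x).symm.le.trans (hop x)
  rw [integral_const_mul, integral_const_mul,
    integral_realOp_of_integral_ruelleOp hint, ← mul_assoc] at h1
  have hne : Nonempty (MarkovSpace A) := nonempty_of_isProbabilityMeasure ν
  obtain ⟨c, hc, hck⟩ := exists_pos_forall_le hkpos
  have h2 : c ≤ ∫ x, k x ∂ν := by
    have h3 := integral_mono (integrable_const (μ := ν) c) (continuousMap_integrable ν k) hck
    simpa using h3
  exact le_of_mul_le_mul_right h1 (hc.trans_le h2)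

theorem IsRuelleEigenvalue.unique {a b : ℝ} (ha : IsRuelleEigenvalue φ a)
    (hb : IsRuelleEigenvalue φ b) : a = b := by
  have h1 := ha.le_exp_mul hb (t := 0) fun x => by simp
  have h2 := hb.le_exp_mul ha (t := 0) fun x => by simp
  rw [Real.exp_zero, one_mul] at h1 h2
  exact le_antisymm h2 h1

/-- For the zero potential, `L ^ k 1` at `x` counts the words of length `k` that can precede `x`. -/
theorem realOp_zero_pow_one (hA : ∀ i j, A i j = 0 ∨ A i j = 1) (k : ℕ) (x : MarkovSpace A) :
    (realOp 0 ^ k) (1 : C(MarkovSpace A, ℝ)) x = ((∑ i, (A ^ k) i (x.1 0) : ℕ) : ℝ) := by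
  induction k generalizing x with
  | zero => simp [Matrix.one_apply]
  | succ k ih =>
    rw [pow_succ', mul_apply_eq_comp, realOp_apply]
    simp only [pow_succ, Matrix.mul_apply]
    rw [Finset.sum_comm, Nat.cast_sum]
    refine Finset.sum_congr rfl fun j _ => ?_
    split_ifs with hj
    · rw [ih, hj]
      simp [cons]
    · simp [(hA _ _).resolve_right hj]

/-- For the zero potential the eigenvalue exceeds `1`, since `A ^ m` has column sums at least
`n ≥ 2`. -/
theorem IsRuelleEigenvalue.one_lt_of_zero (hn : 2 ≤ n) (hA : ∀ i j, A i j = 0 ∨ A i j = 1) {m : ℕ}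
    (hAm : ∀ i j, 0 < (A ^ m) i j) {a : ℝ}
    (ha : IsRuelleEigenvalue (0 : C(MarkovSpace A, ℝ)) a) : 1 < a := by
  obtain ⟨ha0, -, ν, -, hν, -, hint, -⟩ := ha
  have hpow : ∀ k : ℕ, ∫ x, (realOp 0 ^ k) (1 : C(MarkovSpace A, ℝ)) x ∂ν = a ^ k := by
    intro k
    induction k with
    | zero => simp
    | succ k ih =>
      rw [pow_succ', mul_apply_eq_comp, integral_realOp_of_integral_ruelleOp hint, ih, pow_succ']
  have h1 : ∀ x : MarkovSpace A, (2 : ℝ) ≤ (realOp 0 ^ m) (1 : C(MarkovSpace A, ℝ)) x := by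
    intro x
    rw [realOp_zero_pow_one hA]
    have h2 : ∑ _i : Fin n, 1 ≤ ∑ i, (A ^ m) i (x.1 0) := Finset.sum_le_sum fun i _ => hAm i _
    rw [Finset.sum_const, Finset.card_univ, Fintype.card_fin, smul_eq_mul, mul_one] at h2
    exact_mod_cast hn.trans h2
  have h3 := integral_mono (integrable_const (μ := ν) (2 : ℝ)) (continuousMap_integrable ν _) h1
  rw [hpow] at h3
  have h4 : (2 : ℝ) ≤ a ^ m := by simpa using h3
  by_contra! h5
  linarith [pow_le_one₀ ha0.le h5 (n := m)]

/-! ### The potentials `-β log H` -/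

theorem markovDist_le_of_agree {θ : ℝ} (hθ0 : 0 < θ) (hθ1 : θ < 1) {N : ℕ} {x y : MarkovSpace A}
    (h : Agree N x y) : markovDist θ x y ≤ θ ^ N := by
  rw [markovDist]
  split_ifs with hxy
  · positivity
  · refine pow_le_pow_of_le_one hθ0.le hθ1.le ?_
    by_contra! hlt
    exact PiNat.apply_firstDiff_ne (E := fun _ => Fin n)
      (fun h' => hxy (Subtype.ext h')) (h _ hlt.le)

theorem markovDist_nonneg {θ : ℝ} (hθ0 : 0 < θ) (x y : MarkovSpace A) : 0 ≤ markovDist θ x y := by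
  rw [markovDist]
  split_ifs <;> positivity

theorem log_sub_log_le_abs_sub {a b : ℝ} (ha : 1 ≤ a) (hb : 1 ≤ b) :
    Real.log b - Real.log a ≤ |a - b| := by
  have ha0 : 0 < a := by linarith
  have h1 := Real.log_le_sub_one_of_pos (div_pos (zero_lt_one.trans_le hb) ha0)
  rw [Real.log_div (by linarith) ha0.ne', div_sub_one ha0.ne'] at h1
  refine h1.trans ((div_le_div_of_nonneg_right (le_abs_self _) ha0.le).trans ?_)
  rw [abs_sub_comm]
  exact div_le_self (abs_nonneg _) ha

theorem hasVariation_potential {θ K α : ℝ} (hθ0 : 0 < θ) (hθ1 : θ < 1) (hK : 0 < K) (hα : 0 < α)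
    {H : C(MarkovSpace A, ℝ)}
    (hH : ∀ x y, |H x - H y| ≤ K * markovDist θ x y ^ α) (h1 : ∀ y, 1 < H y)
    (h0 : ∀ y, 0 < H y) {β : ℝ} (hβ : 0 ≤ β) :
    HasVariation (θ ^ α) (β * K) (potential H h0 β) := by
  intro N x y h
  have h2 : markovDist θ x y ^ α ≤ (θ ^ α) ^ N := by
    refine (Real.rpow_le_rpow (markovDist_nonneg hθ0 x y) (markovDist_le_of_agree hθ0 hθ1 h)
      hα.le).trans_eq ?_
    rw [← Real.rpow_natCast, ← Real.rpow_natCast, ← Real.rpow_mul hθ0.le, ← Real.rpow_mul hθ0.le,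
      mul_comm]
  have h3 : Real.log (H y) - Real.log (H x) ≤ K * (θ ^ α) ^ N :=
    (log_sub_log_le_abs_sub (h1 x).le (h1 y).le).trans ((hH x y).trans (by gcongr))
  have h4 := mul_le_mul_of_nonneg_left h3 hβ
  change -β * Real.log (H x) - -β * Real.log (H y) ≤ _
  linarith

/-- A function on `[0, ∞)` with `g 0 > 0` that decreases at a rate between `p > 0` and `q` has
exactly one positive zero. -/
theorem existsUnique_pos_zero {g : ℝ → ℝ} {p q : ℝ} (hp : 0 < p) (hg0 : 0 < g 0)
    (hup : ∀ s t, 0 ≤ s → s ≤ t → g t ≤ g s - p * (t - s))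
    (hlow : ∀ s t, 0 ≤ s → s ≤ t → g s ≤ g t + q * (t - s)) :
    ∃! t : ℝ, 0 < t ∧ g t = 0 := by
  have hb : 0 ≤ g 0 / p := by positivity
  have key : ∀ s t, 0 ≤ s → s ≤ t → |g s - g t| ≤ |q| * |s - t| := by
    intro s t hs hst
    have h1 := hup s t hs hst
    have h2 := hlow s t hs hst
    have h3 : q * (t - s) ≤ |q| * (t - s) :=
      mul_le_mul_of_nonneg_right (le_abs_self q) (sub_nonneg.2 hst)
    have h4 : 0 ≤ p * (t - s) := mul_nonneg hp.le (sub_nonneg.2 hst)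
    rw [abs_sub_comm s t, abs_of_nonneg (sub_nonneg.2 hst), abs_le]
    constructor <;> linarith
  have hcont : ContinuousOn g (Set.Icc 0 (g 0 / p)) := by
    refine (LipschitzOnWith.of_dist_le_mul (K := ‖q‖₊) fun s hs t ht => ?_).continuousOn
    rw [Real.dist_eq, Real.dist_eq, coe_nnnorm, Real.norm_eq_abs]
    rcases le_total s t with hst | hst
    · exact key s t hs.1 hst
    · rw [abs_sub_comm, abs_sub_comm s]
      exact key t s ht.1 hst
  have hgb : g (g 0 / p) ≤ 0 := by
    have h1 := hup 0 _ le_rfl hb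
    rw [sub_zero, mul_div_cancel₀ _ hp.ne', sub_self] at h1
    exact h1
  obtain ⟨t, ht, hgt⟩ := intermediate_value_Icc' hb hcont ⟨hgb, hg0.le⟩
  refine ⟨t, ⟨lt_of_le_of_ne ht.1 fun h => ?_, hgt⟩, ?_⟩
  · rw [← h] at hgt
    exact hg0.ne' hgt
  · rintro s ⟨hs, hgs⟩
    rcases lt_trichotomy s t with h | h | h
    · have := hup s t hs.le h.le
      nlinarith
    · exact h
    · have := hup t s ht.1 h.le
      nlinarith

end

end MarkovSpace

open MarkovSpace

theorem corollary2p9 (n : ℕ) (hn : 2 ≤ n) (A : Matrix (Fin n) (Fin n) ℕ)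
    (hA : ∀ i j, A i j = 0 ∨ A i j = 1)
    (hAm : ∃ m : ℕ, 0 < m ∧ ∀ i j, 0 < (A ^ m) i j)
    (θ : ℝ) (hθ0 : 0 < θ) (hθ1 : θ < 1)
    (H : C(MarkovSpace A, ℝ)) (hHolder : MarkovSpace.IsHolder θ H) (hH : ∀ y, 1 < H y) :
    ∃ lam : ℝ → ℝ,
      (∀ β : ℝ, 0 ≤ β → ∀ μ : ℝ,
        MarkovSpace.IsRuelleEigenvalue
          (MarkovSpace.potential H (fun y => zero_lt_one.trans (hH y)) β) μ ↔ μ = lam β) ∧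
      ∃! β : ℝ, 0 < β ∧ lam β = 1 := by
  obtain ⟨m, hm, hAm⟩ := hAm
  obtain ⟨K, α, hK, hα, hHol⟩ := hHolder
  have h0 : ∀ y, 0 < H y := fun y => zero_lt_one.trans (hH y)
  have hne : Nonempty (MarkovSpace A) := nonempty_of_primitive (by omega) hA hm hAm
  have hex : ∀ β : ℝ, ∃ l : ℝ, 0 ≤ β → IsRuelleEigenvalue (potential H h0 β) l := by
    intro β
    by_cases hβ : 0 ≤ β
    · obtain ⟨l, hl⟩ := exists_isRuelleEigenvalue (by omega) hA hm hAm
        (Real.rpow_pos_of_pos hθ0 α) (Real.rpow_lt_one hθ0.le hθ1 hα) (by positivity)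
        (hasVariation_potential hθ0 hθ1 hK hα hHol hH h0 hβ)
      exact ⟨l, fun _ => hl⟩
    · exact ⟨0, fun h => absurd h hβ⟩
  choose lam hlam using hex
  refine ⟨lam, fun β hβ μ => ⟨fun h => h.unique (hlam β hβ), fun h => h ▸ hlam β hβ⟩, ?_⟩
  have hpos : ∀ β, 0 ≤ β → 0 < lam β := fun β hβ => (hlam β hβ).1
  -- bounds for `log H`, which control the rate at which `log (lam β)` decreases
  let G : C(MarkovSpace A, ℝ) := ⟨fun x => Real.log (H x), H.continuous.log fun x => (h0 x).ne'⟩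
  obtain ⟨p, hp, hpG⟩ := exists_pos_forall_le (h := G) fun x => Real.log_pos (hH x)
  have hGq : ∀ x, G x ≤ ‖G‖ := fun x => (le_abs_self _).trans (G.norm_coe_le_norm x)
  have hpot : ∀ β x, potential H h0 β x = -β * G x := fun _ _ => rfl
  have hzero : 1 < lam 0 := by
    have h1 := hlam 0 le_rfl
    have h2 : potential H h0 0 = 0 := by
      ext x
      simp [hpot]
    rw [h2] at h1
    exact h1.one_lt_of_zero hn hA hAm
  have hup : ∀ s t, 0 ≤ s → s ≤ t →
      Real.log (lam t) ≤ Real.log (lam s) - p * (t - s) := by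
    intro s t hs hst
    have h1 := (hlam s hs).le_exp_mul (hlam t (hs.trans hst)) (t := -(p * (t - s))) fun x => by
      rw [hpot, hpot]
      nlinarith [hpG x]
    have h2 := Real.log_le_log (hpos t (hs.trans hst)) h1
    rw [Real.log_mul (Real.exp_pos _).ne' (hpos s hs).ne', Real.log_exp] at h2
    linarith
  have hlow : ∀ s t, 0 ≤ s → s ≤ t →
      Real.log (lam s) ≤ Real.log (lam t) + ‖G‖ * (t - s) := by
    intro s t hs hst
    have h1 := (hlam t (hs.trans hst)).le_exp_mul (hlam s hs) (t := ‖G‖ * (t - s)) fun x => by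
      rw [hpot, hpot]
      nlinarith [hGq x]
    have h2 := Real.log_le_log (hpos s hs) h1
    rw [Real.log_mul (Real.exp_pos _).ne' (hpos t (hs.trans hst)).ne', Real.log_exp] at h2
    linarith
  obtain ⟨β, ⟨hβ, hβ1⟩, huniq⟩ :=
    existsUnique_pos_zero (g := fun β => Real.log (lam β)) hp (Real.log_pos hzero) hup hlow
  refine ⟨β, ⟨hβ, Real.eq_one_of_pos_of_log_eq_zero (hpos β hβ.le) hβ1⟩, ?_⟩
  rintro t ⟨ht, ht1⟩
  exact huniq t ⟨ht, by simp [ht1]⟩
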